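/- Let $k$ be an algebraically closed field of characteristic $0$, let $m,n\ge 1$ be integers, and let $G=\mathbb{Z}_m\times\mathbb{Z}_n$, written multiplicatively, where $g_1$ is a generator of $\mathbb{Z}_m$ and $g_2$ a generator of $\mathbb{Z}_n$. Let $\zeta_m,\zeta_n\in k^*$ be primitive $m$-th and $n$-th roots of unity. Write $(m,n)$ for the greatest common divisor of $m$ and $n$, and $[x]$ for the integer part of $x$. For natural numbers $a,b,d$ define $\Phi_{a,b,d}\colon G^3\to k^*$ by $$\Phi_{a,b,d}(g_1^i g_2^j,\; g_1^s g_2^t,\; g_1^k g_2^l)=\zeta_m^{a[\frac{k+s}{m}]i}\,\zeta_n^{b[\frac{k+s}{m}]j}\,\zeta_n^{d[\frac{t+l}{n}]j}\qquad(0\le i,s,k<m,\ 0\le j,t,l<n).$$ Then every $\Phi_{a,b,d}$ is a normalized $3$-cocycle on $G$ with coefficients in the trivial $G$-module $k^*$ (normalized means that its value is $1$ whenever one of its arguments is the identity), and the set $\{\Phi_{a,b,d}\mid 0\le a<m,\ 0\le b<(m,n),\ 0\le d<n\}$ is a complete set of representatives of $H^3(G,k^*)$: the map $(a,b,d)\mapsto[\Phi_{a,b,d}]$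 from the set of triples of integers with $0\le a<m$, $0\le b<(m,n)$, $0\le d<n$ to $H^3(G,k^*)$ is a bijection. -/

import Mathlib

universe u

namespace TwoCyclic

/-- The exponent of `x` with respect to `g`: the least natural number `i` with `g ^ i = x`.
If `g` generates a finite cyclic group of order `m`, this is the unique `i < m` with `g ^ i = x`
(see `pow_exponent`, `exponent_lt` and `exponent_pow` below). -/
noncomputable def exponent {C : Type u} [Group C] (g x : C) : ℕ :=
  sInf {i : ℕ | g ^ i = x}

theorem exponent_pow {C : Type u} [Group C] (g : C) {i : ℕ} (hi : i < orderOf g) :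
    exponent g (g ^ i) = i := by
  have hmem : exponent g (g ^ i) ∈ {j : ℕ | g ^ j = g ^ i} := Nat.sInf_mem ⟨i, rfl⟩
  have hle : exponent g (g ^ i) ≤ i := Nat.sInf_le (show g ^ i = g ^ i from rfl)
  exact pow_injOn_Iio_orderOf (Set.mem_Iio.2 (hle.trans_lt hi)) (Set.mem_Iio.2 hi) hmem

theorem exists_pow_of_generator {C : Type u} [Group C] {g : C}
    (hg : ∀ x : C, x ∈ Subgroup.zpowers g) (h0 : 0 < orderOf g) (x : C) :
    ∃ i : ℕ, i < orderOf g ∧ g ^ i = x := by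
  obtain ⟨j, hj⟩ := (orderOf_pos_iff.1 h0).mem_powers_iff_mem_zpowers.2 (hg x)
  exact ⟨j % orderOf g, Nat.mod_lt _ h0, by rw [pow_mod_orderOf]; exact hj⟩

theorem pow_exponent {C : Type u} [Group C] {g : C}
    (hg : ∀ x : C, x ∈ Subgroup.zpowers g) (h0 : 0 < orderOf g) (x : C) :
    g ^ exponent g x = x := by
  obtain ⟨i, hi, rfl⟩ := exists_pow_of_generator hg h0 x
  rw [exponent_pow g hi]

theorem exponent_lt {C : Type u} [Group C] {g : C}
    (hg : ∀ x : C, x ∈ Subgroup.zpowers g) (h0 : 0 < orderOf g) (x : C) :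
    exponent g x < orderOf g := by
  obtain ⟨i, hi, rfl⟩ := exists_pow_of_generator hg h0 x
  rwa [exponent_pow g hi]

/-- The map `Φ_{a,b,d} : (C₁ × C₂)³ → kˣ`,
`Φ_{a,b,d}(g₁^i g₂^j, g₁^s g₂^t, g₁^k g₂^l)
  = ζ_m ^ (a [(k+s)/m] i) * ζ_n ^ (b [(k+s)/m] j) * ζ_n ^ (d [(t+l)/n] j)`,
where `C₁`, `C₂` are generated by `g₁`, `g₂`, of orders `m`, `n`, and `0 ≤ i, s, k < m`,
`0 ≤ j, t, l < n`. The division is that of natural numbers, i.e. the integer part. -/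
noncomputable def Phi {C₁ C₂ K : Type u} [Group C₁] [Group C₂] [Field K] (m n : ℕ)
    (g₁ : C₁) (g₂ : C₂) (ζm ζn : Kˣ) (a b d : ℕ) (x y z : C₁ × C₂) : Kˣ :=
  ζm ^ (a * ((exponent g₁ z.1 + exponent g₁ y.1) / m) * exponent g₁ x.1) *
    ζn ^ (b * ((exponent g₁ z.1 + exponent g₁ y.1) / m) * exponent g₂ x.2) *
    ζn ^ (d * ((exponent g₂ y.2 + exponent g₂ z.2) / n) * exponent g₂ x.2)

/-- `Kˣ`, written additively, as a `G`-module with trivial action. The ring of integers is lifted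
to the universe of `G` and `K` because group cohomology asks for a common universe. -/
noncomputable abbrev unitsRep (G K : Type u) [Group G] [Field K] : Rep (ULift.{u} ℤ) G :=
  Rep.trivial (ULift.{u} ℤ) G (Additive Kˣ)

/-- A map `G³ → Kˣ` as an inhomogeneous (bar) 3-cochain of `G` with coefficients in the trivial
module `Kˣ`. -/
def toCochain {G K : Type u} [Group G] [Field K] (f : G → G → G → Kˣ) :
    (Fin 3 → G) → unitsRep G K :=
  fun v => Additive.ofMul (f (v 0) (v 1) (v 2))

/-- `f` is a 3-cocycle on `G` with values in the trivial module `Kˣ`. -/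
def IsCocycle {G K : Type u} [Group G] [Field K] (f : G → G → G → Kˣ) : Prop :=
  inhomogeneousCochains.d (unitsRep G K) 3 (toCochain f) = 0

/-- `f` is normalized: it takes the value `1` as soon as one argument is the identity. -/
def IsNormalized {G K : Type u} [Group G] [Field K] (f : G → G → G → Kˣ) : Prop :=
  ∀ x y : G, f 1 x y = 1 ∧ f x 1 y = 1 ∧ f x y 1 = 1

/-- The class in `H³(G, Kˣ)` of a 3-cocycle. -/
noncomputable def cocycleClass {G K : Type u} [Group G] [Field K] (f : G → G → G → Kˣ)
    (hf : IsCocycle f) : groupCohomology (unitsRep G K) 3 :=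
  groupCohomology.π (unitsRep G K) 3 (groupCohomology.cocyclesMk (toCochain f) hf)

end TwoCyclic

namespace TwoCyclic

open CategoryTheory

/-! ### Exact sequences of representations and a cardinality bound -/

section Exactness

variable {k G : Type u} [CommRing k] [Group G]

/-! The classes of the `Phi` are shown to be pairwise distinct, and `H³` to have at most `m * gcd(m,
n) * n` elements; together these give bijectivity.

Upper bound. Let `A = Kˣ` with trivial action and let `X` be `A` coinduced from `C₁` to `C₁ × C₂`.
As `C₂` is cyclic, there is an exact sequence `0 ⟶ A ⟶ X ⟶ X ⟶ A ⟶ 0` (constants, translation by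
`g₂` minus identity, sum over `C₂`). Split it at the kernel `B` of the sum. By Shapiro, `Hⁱ(X) =
Hⁱ(C₁, A)`: this vanishes for `i = 2` because `A` is divisible, and has at most `m` elements for `i
= 3`. Hence `H¹(A) = Hom(C₁ × C₂, A)` maps onto `H²(B)`, which turns out to have at most `gcd(m, n)
* n` elements (`card_groupCohomology_two_kernel_le`), and `H²(B) ⟶ H³(A) ⟶ H³(X)` gives the bound.

Lower bound. If `g ^ N = 1`, the product of `f g (g ^ i) g` over `i < N` depends only on the class
of `f` (`prod_eq_of_coboundary`). Its values at `(g₁, 1)`, `(1, g₂)` and `(g₁, g₂)` recover `a`, `d`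
and `b` (`Phi_injective`). -/

theorem rep_exact_of_ker_le_range {S : ShortComplex (Rep.{u} k G)}
    (h : ∀ x : S.X₂, S.g.hom x = 0 → ∃ y : S.X₁, S.f.hom y = x) : S.Exact := by
  refine ((forget₂ (Rep.{u} k G) (ModuleCat.{u} k)).reflects_exact_of_faithful S) ?_
  rw [ShortComplex.moduleCat_exact_iff]
  exact h

theorem card_le_mul_of_exact {S : ShortComplex (ModuleCat.{u} k)} (hS : S.Exact)
    [Finite S.X₁] [Finite S.X₃] :
    Finite S.X₂ ∧ Nat.card S.X₂ ≤ Nat.card S.X₁ * Nat.card S.X₃ := by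
  rw [ShortComplex.moduleCat_exact_iff_range_eq_ker] at hS
  let K := LinearMap.ker S.g.hom
  have hK : Finite K := by
    have : Finite (LinearMap.range S.f.hom) :=
      Finite.of_surjective _ (LinearMap.surjective_rangeRestrict S.f.hom)
    rwa [hS] at this
  have hKc : Nat.card K ≤ Nat.card S.X₁ := by
    have : Nat.card (LinearMap.range S.f.hom) ≤ Nat.card S.X₁ :=
      Nat.card_le_card_of_surjective _ (LinearMap.surjective_rangeRestrict S.f.hom)
    rwa [hS] at this
  have e := S.g.hom.quotKerEquivRange
  have hQ : Finite (S.X₂ ⧸ K) := Finite.of_equiv _ e.symm.toEquiv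
  have hQc : Nat.card (S.X₂ ⧸ K) ≤ Nat.card S.X₃ := by
    rw [Nat.card_congr e.toEquiv]
    exact Nat.card_le_card_of_injective _ Subtype.val_injective
  have e' : S.X₂ ≃ (S.X₂ ⧸ K) × K := AddSubgroup.addGroupEquivQuotientProdAddSubgroup
  refine ⟨Finite.of_equiv _ e'.symm, ?_⟩
  rw [Nat.card_congr e', Nat.card_prod, mul_comm]
  exact Nat.mul_le_mul hKc hQc

/-- Splicing an exact sequence `0 ⟶ A ⟶ X ⟶ Y ⟶ C ⟶ 0` at the kernel `B` of `Y ⟶ C`. -/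
theorem shortExact_kernel_lift {A X Y C : Rep.{u} k G} (i : A ⟶ X) (t : X ⟶ Y) (s : Y ⟶ C)
    (hit : i ≫ t = 0) (hts : t ≫ s = 0) [Mono i] [Epi s]
    (h₁ : (ShortComplex.mk i t hit).Exact) (h₂ : (ShortComplex.mk t s hts).Exact) :
    (ShortComplex.mk i (Limits.kernel.lift s t hts)
      (by rw [← cancel_mono (Limits.kernel.ι s)]; simp [hit])).ShortExact where
  exact := by
    let φ : ShortComplex.mk i (Limits.kernel.lift s t hts)
      (by rw [← cancel_mono (Limits.kernel.ι s)]; simp [hit]) ⟶ ShortComplex.mk i t hit :=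
      { τ₁ := 𝟙 _, τ₂ := 𝟙 _, τ₃ := Limits.kernel.ι s }
    have : Epi φ.τ₁ := inferInstanceAs (Epi (𝟙 _))
    have : IsIso φ.τ₂ := inferInstanceAs (IsIso (𝟙 _))
    have : Mono φ.τ₃ := inferInstanceAs (Mono (Limits.kernel.ι s))
    exact (ShortComplex.exact_iff_of_epi_of_isIso_of_mono φ).2 h₁
  mono_f := inferInstance
  epi_g := (ShortComplex.exact_iff_epi_kernel_lift _).1 h₂

theorem shortExact_kernel {Y C : Rep.{u} k G} (s : Y ⟶ C) [Epi s] :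
    (ShortComplex.mk (Limits.kernel.ι s) s (by simp)).ShortExact where
  exact := ShortComplex.exact_kernel s
  mono_f := inferInstance
  epi_g := inferInstance

end Exactness

/-! ### Cohomology of a finite cyclic group with trivial coefficients -/

section Cyclic

variable {k G A : Type u} [CommRing k] [Group G] [Finite G] [AddCommGroup A] [Module k A]
  {g : G} (hg : ∀ x, x ∈ Subgroup.zpowers g)

/-- Allows commutativity to be assumed without changing the given group structure. -/
theorem exists_commGroup_of_generator {G : Type u} [I : Group G] {g : G}
    (hg : ∀ x, x ∈ Subgroup.zpowers g) : ∃ J : CommGroup G, J.toGroup = I :=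
  have : IsCyclic G := ⟨⟨g, hg⟩⟩
  ⟨IsCyclic.commGroup, rfl⟩

include hg

open Rep.FiniteCyclicGroup in
-- Even cohomology is invariants modulo norms; for a trivial action the norm is multiplication by
-- the group order, onto by divisibility.
theorem subsingleton_groupCohomology_even (hA : ∀ a : A, ∃ b : A, Nat.card G • b = a)
    (i : ℕ) [NeZero i] (hi : Even i) :
    Subsingleton (groupCohomology (Rep.trivial k G A) i) := by
  obtain ⟨J, rfl⟩ := exists_commGroup_of_generator hg
  have := Fintype.ofFinite G
  refine ⟨fun x y => ?_⟩
  have h0 : ∀ x : groupCohomology (Rep.trivial k G A) i, x = 0 := by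
    intro x
    have : Epi (groupCohomologyπEven (Rep.trivial k G A) g hg i hi) :=
      epi_comp' (@IsIso.epi_of_iso _ _ _ _ _ (Iso.isIso_inv _)) (epi_comp' inferInstance inferInstance)
    obtain ⟨y, rfl⟩ := (ModuleCat.epi_iff_surjective _).1 this x
    rw [groupCohomologyπEven_eq_zero_iff]
    obtain ⟨b, hb⟩ := hA y.1
    exact ⟨b, by simpa [Rep.norm, Representation.norm] using hb⟩
  rw [h0 x, h0 y]

open Rep.FiniteCyclicGroup in
-- Odd cohomology is a quotient of the kernel of the norm, which here is the torsion killed by the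
-- group order.
theorem card_groupCohomology_odd_le [Finite {a : A // Nat.card G • a = 0}] (i : ℕ) (hi : Odd i) :
    Finite (groupCohomology (Rep.trivial k G A) i) ∧
      Nat.card (groupCohomology (Rep.trivial k G A) i) ≤ Nat.card {a : A // Nat.card G • a = 0} := by
  obtain ⟨J, rfl⟩ := exists_commGroup_of_generator hg
  have := Fintype.ofFinite G
  have : Epi (groupCohomologyπOdd (Rep.trivial k G A) g hg i hi) :=
    epi_comp' (@IsIso.epi_of_iso _ _ _ _ _ (Iso.isIso_inv _)) (epi_comp' inferInstance inferInstance)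
  have hs := (ModuleCat.epi_iff_surjective _).1 this
  let f : {a : A // Nat.card G • a = 0} → groupCohomology (Rep.trivial k G A) i := fun a =>
    groupCohomologyπOdd (Rep.trivial k G A) g hg i hi ⟨a.1, by
      simpa [Rep.norm, Representation.norm] using a.2⟩
  have hf : Function.Surjective f := by
    intro x
    obtain ⟨y, rfl⟩ := hs x
    exact ⟨⟨y.1, by simpa [Rep.norm, Representation.norm] using y.2⟩, rfl⟩
  exact ⟨Finite.of_surjective f hf, Nat.card_le_card_of_surjective f hf⟩

end Cyclic
-- The four-term exact sequence of the coinduced module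
section Coinduced

variable {k C₁ C₂ A : Type u} [CommRing k] [CommGroup C₁] [CommGroup C₂]
  [AddCommGroup A] [Module k A]

variable (k C₁ C₂ A) in
/-- The trivial module `A` coinduced from `C₁` to `C₁ × C₂`, i.e. the functions `C₁ × C₂ → A`
which only depend on the second component. -/
noncomputable abbrev coindTrivial : Rep.{u} k (C₁ × C₂) :=
  Rep.coind (MonoidHom.snd C₁ C₂).ker.subtype (Rep.trivial k (MonoidHom.snd C₁ C₂).ker A)

theorem coindTrivial_apply_mk (f : coindTrivial k C₁ C₂ A) (x x' : C₁) (y : C₂) :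
    f.1 (x, y) = f.1 (x', y) := by
  have := f.2 ⟨(x * x'⁻¹, 1), (MonoidHom.snd C₁ C₂).mem_ker.2 rfl⟩ (x', y)
  simpa using this

/-- The function on `C₁ × C₂` obtained from a function on `C₂`. -/
def coindTrivialMk (φ : C₂ → A) : coindTrivial k C₁ C₂ A :=
  ⟨fun x => φ x.2, fun s h => by
    have : s.1.2 = 1 := s.2
    simp [this]⟩

@[simp]
theorem coindTrivialMk_apply (φ : C₂ → A) (x : C₁ × C₂) :
    (coindTrivialMk φ : coindTrivial k C₁ C₂ A).1 x = φ x.2 := rfl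

variable (k C₁ C₂ A) in
/-- The inclusion of the constant functions. -/
noncomputable def coindTrivialConst : Rep.trivial k (C₁ × C₂) A ⟶ coindTrivial k C₁ C₂ A :=
  Rep.ofHom ⟨{ toFun := fun a => coindTrivialMk fun _ => a
               map_add' := fun _ _ => rfl
               map_smul' := fun _ _ => rfl }, fun _ => rfl⟩

theorem coindTrivialConst_apply (a : A) (x : C₁ × C₂) :
    ((coindTrivialConst k C₁ C₂ A).hom a).1 x = a := rfl

variable (k C₁ A) in
/-- The difference of the translate by `g` and the identity. -/
noncomputable def coindTrivialDiff (g : C₂) : coindTrivial k C₁ C₂ A ⟶ coindTrivial k C₁ C₂ A :=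
  Rep.applyAsHom (coindTrivial k C₁ C₂ A) (1, g) - 𝟙 _

theorem sum_range_orderOf_comp_mul {g : C₂} (hg : ∀ x : C₂, x ∈ Subgroup.zpowers g)
    (h0 : 0 < orderOf g) (φ : C₂ → A) (y : C₂) :
    ∑ j ∈ Finset.range (orderOf g), φ (g ^ j * y) = ∑ j ∈ Finset.range (orderOf g), φ (g ^ j) := by
  obtain ⟨i, -, rfl⟩ := exists_pow_of_generator hg h0 y
  induction i with
  | zero => simp
  | succ i ih =>
    rw [← ih]
    have h := Finset.sum_range_succ' (fun j => φ (g ^ j * g ^ i)) (orderOf g)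
    rw [Finset.sum_range_succ] at h
    simp only [pow_orderOf_eq_one, pow_zero, add_left_inj] at h
    rw [h]
    exact Finset.sum_congr rfl fun j _ => by rw [pow_succ', pow_succ, mul_assoc]

variable (k C₁ A) in
/-- The sum of the values of a function over the cyclic group `C₂`. -/
noncomputable def coindTrivialSum {g : C₂} (hg : ∀ x : C₂, x ∈ Subgroup.zpowers g)
    (h0 : 0 < orderOf g) : coindTrivial k C₁ C₂ A ⟶ Rep.trivial k (C₁ × C₂) A :=
  Rep.ofHom ⟨{ toFun := fun f => ∑ j ∈ Finset.range (orderOf g), f.1 (1, g ^ j)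
               map_add' := fun f f' => Finset.sum_add_distrib
               map_smul' := fun r f => by rw [RingHom.id_apply, Finset.smul_sum]; rfl }, fun x => by
    ext f
    have := sum_range_orderOf_comp_mul hg h0 (fun y => f.1 (1, y)) x.2
    change ∑ j ∈ Finset.range (orderOf g), f.1 ((1, g ^ j) * x) =
      ∑ j ∈ Finset.range (orderOf g), f.1 (1, g ^ j)
    rw [← this]
    exact Finset.sum_congr rfl fun j _ => coindTrivial_apply_mk f _ _ _⟩

theorem coindTrivialSum_apply {g : C₂} (hg : ∀ x : C₂, x ∈ Subgroup.zpowers g)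
    (h0 : 0 < orderOf g) (f : coindTrivial k C₁ C₂ A) :
    (coindTrivialSum k C₁ A hg h0).hom f = ∑ j ∈ Finset.range (orderOf g), f.1 (1, g ^ j) := rfl

theorem coindTrivial_ext {f f' : coindTrivial k C₁ C₂ A} (h : ∀ y, f.1 (1, y) = f'.1 (1, y)) :
    f = f' := by
  refine Subtype.ext (funext fun x => ?_)
  rw [← Prod.mk.eta (p := x), coindTrivial_apply_mk f x.1 1, coindTrivial_apply_mk f' x.1 1, h]

instance : Mono (coindTrivialConst k C₁ C₂ A) := by
  rw [Rep.mono_iff_injective]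
  intro a b h
  rw [← coindTrivialConst_apply (k := k) a (1 : C₁ × C₂), h, coindTrivialConst_apply]

theorem epi_coindTrivialSum {g : C₂} (hg : ∀ x : C₂, x ∈ Subgroup.zpowers g)
    (h0 : 0 < orderOf g) : Epi (coindTrivialSum k C₁ A hg h0) := by
  classical
  rw [Rep.epi_iff_surjective]
  intro a
  refine ⟨coindTrivialMk fun y => if y = 1 then a else 0, ?_⟩
  rw [coindTrivialSum_apply, Finset.sum_eq_single 0]
  · simp
  · intro j hj hj0
    simp only [coindTrivialMk_apply]
    exact if_neg (pow_ne_one_of_lt_orderOf hj0 (Finset.mem_range.1 hj))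
  · exact fun h => absurd (Finset.mem_range.2 h0) h

theorem coindTrivialConst_comp_diff (g : C₂) :
    coindTrivialConst k C₁ C₂ A ≫ coindTrivialDiff k C₁ A g = 0 := by
  ext a
  exact sub_self a

theorem coindTrivialDiff_comp_sum {g : C₂} (hg : ∀ x : C₂, x ∈ Subgroup.zpowers g)
    (h0 : 0 < orderOf g) : coindTrivialDiff k C₁ A g ≫ coindTrivialSum k C₁ A hg h0 = 0 := by
  ext f
  change (coindTrivialSum k C₁ A hg h0).hom ((coindTrivialDiff k C₁ A g).hom f) = 0
  refine (coindTrivialSum_apply hg h0 _).trans ((Finset.sum_sub_distrib _ _).trans ?_)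
  rw [sub_eq_zero]
  exact (Finset.sum_congr rfl fun j _ => coindTrivial_apply_mk f _ _ _).trans
    (sum_range_orderOf_comp_mul hg h0 (fun y => f.1 (1, y)) g)

theorem exact_coindTrivialConst_diff {g : C₂} (hg : ∀ x : C₂, x ∈ Subgroup.zpowers g)
    (h0 : 0 < orderOf g) :
    (ShortComplex.mk _ _ (coindTrivialConst_comp_diff (k := k) (C₁ := C₁) (A := A) g)).Exact := by
  refine rep_exact_of_ker_le_range fun f hf => ⟨f.1 1, coindTrivial_ext fun y => ?_⟩
  have hf' : ∀ x : C₁ × C₂, f.1 (x * (1, g)) = f.1 x := fun x =>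
    sub_eq_zero.1 (congrArg (fun f' : coindTrivial k C₁ C₂ A => f'.1 x) hf)
  obtain ⟨i, -, rfl⟩ := exists_pow_of_generator hg h0 y
  change f.1 1 = _
  induction i with
  | zero => rw [pow_zero]; rfl
  | succ i ih => rw [ih, ← hf', pow_succ]; simp

theorem exact_coindTrivialDiff_sum {g : C₂} (hg : ∀ x : C₂, x ∈ Subgroup.zpowers g)
    (h0 : 0 < orderOf g) :
    (ShortComplex.mk _ _
      (coindTrivialDiff_comp_sum (k := k) (C₁ := C₁) (A := A) hg h0)).Exact := by
  refine rep_exact_of_ker_le_range fun f hf => ?_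
  -- A discrete antiderivative of `f` along the powers of `g`. The vanishing of the total sum makes
  -- it periodic, so that it descends to `C₂`.
  let s : ℕ → A := fun i => ∑ j ∈ Finset.range i, f.1 (1, g ^ j)
  have hs0 : s (orderOf g) = 0 := hf
  have hper : Function.Periodic s (orderOf g) := fun i => by
    simp only [s]
    rw [add_comm, Finset.sum_range_add, show ∑ j ∈ Finset.range (orderOf g), f.1 (1, g ^ j) = 0
      from hs0, zero_add]
    simp [pow_add, pow_orderOf_eq_one]
  have hs : ∀ {i j : ℕ}, g ^ i = g ^ j → s i = s j := fun {i j} h => by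
    rw [← hper.map_mod_nat i, ← hper.map_mod_nat j, pow_eq_pow_iff_modEq.1 h]
  refine ⟨coindTrivialMk fun y => s (exponent g y), coindTrivial_ext fun y => ?_⟩
  change s (exponent g (y * g)) - s (exponent g y) = f.1 (1, y)
  have h1 : s (exponent g (y * g)) = s (exponent g y + 1) :=
    hs (by rw [pow_exponent hg h0, pow_succ, pow_exponent hg h0])
  rw [h1]
  simp only [s]
  rw [Finset.sum_range_succ, add_sub_cancel_left, pow_exponent hg h0]

end Coinduced

theorem card_le_mul_of_generators {M : Type*} [AddCommGroup M] {p q : M} {a b : ℕ} (ha : 0 < a)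
    (hb : 0 < b) (hp : a • p = 0) (hq : b • q = 0) (h : ∀ x : M, ∃ i j : ℕ, x = i • p + j • q) :
    Finite M ∧ Nat.card M ≤ a * b := by
  let f : Fin a × Fin b → M := fun r => (r.1 : ℕ) • p + (r.2 : ℕ) • q
  have hmod : ∀ {c : ℕ} {r : M}, c • r = 0 → ∀ i : ℕ, i • r = (i % c) • r := fun {c r} hr i => by
    conv_lhs => rw [← Nat.mod_add_div i c, add_nsmul, mul_comm, mul_nsmul', hr, nsmul_zero,
      add_zero]
  have hf : Function.Surjective f := fun x => by
    obtain ⟨i, j, rfl⟩ := h x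
    exact ⟨(⟨i % a, Nat.mod_lt _ ha⟩, ⟨j % b, Nat.mod_lt _ hb⟩), by
      simp only [f]; rw [← hmod hp, ← hmod hq]⟩
  exact ⟨Finite.of_surjective f hf, by simpa using Nat.card_le_card_of_surjective f hf⟩

section Character

variable {C A : Type u} [Group C] [AddCommGroup A] {g : C}

theorem exponent_mul_nsmul (hg : ∀ x : C, x ∈ Subgroup.zpowers g) (h0 : 0 < orderOf g) {z : A}
    (hz : orderOf g • z = 0) (x y : C) :
    exponent g (x * y) • z = exponent g x • z + exponent g y • z := by
  rw [← add_nsmul]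
  have h : exponent g (x * y) ≡ exponent g x + exponent g y [MOD orderOf g] := by
    rw [← pow_eq_pow_iff_modEq, pow_add, pow_exponent hg h0, pow_exponent hg h0,
      pow_exponent hg h0]
  have hd := addOrderOf_dvd_of_nsmul_eq_zero hz
  exact nsmul_eq_nsmul_iff_modEq.2 (h.of_dvd hd)

end Character

/-! ### The upper bound for the third cohomology group -/

section Bound

variable {k C₁ C₂ A : Type u} [CommRing k] [CommGroup C₁] [CommGroup C₂]
  [AddCommGroup A] [Module k A] {g₁ : C₁} {g₂ : C₂}

theorem ker_snd_generator (hg₁ : ∀ x : C₁, x ∈ Subgroup.zpowers g₁)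
    (x : (MonoidHom.snd C₁ C₂).ker) :
    x ∈ Subgroup.zpowers (⟨(g₁, 1), rfl⟩ : (MonoidHom.snd C₁ C₂).ker) := by
  obtain ⟨⟨x, y⟩, hy : y = 1⟩ := x
  obtain ⟨i, hi⟩ := Subgroup.mem_zpowers_iff.1 (hg₁ x)
  exact Subgroup.mem_zpowers_iff.2 ⟨i, by ext <;> simp [hi, hy]⟩

variable (C₁ C₂) in
/-- The kernel of the second projection is the first factor. -/
def kerSndEquiv : (MonoidHom.snd C₁ C₂).ker ≃ C₁ where
  toFun x := x.1.1
  invFun x := ⟨(x, 1), rfl⟩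
  left_inv := by rintro ⟨⟨x, y⟩, hy : y = 1⟩; simp [hy]
  right_inv _ := rfl

/-- Shapiro's lemma reduces this to the cyclic group `C₁`. -/
theorem subsingleton_groupCohomology_two_coindTrivial [Finite C₁]
    (hg₁ : ∀ x : C₁, x ∈ Subgroup.zpowers g₁) (hA : ∀ a : A, ∃ b : A, Nat.card C₁ • b = a) :
    Subsingleton (groupCohomology (coindTrivial k C₁ C₂ A) 2) := by
  have : Finite (MonoidHom.snd C₁ C₂).ker := Finite.of_equiv _ (kerSndEquiv C₁ C₂).symm
  have := subsingleton_groupCohomology_even (k := k) (A := A) (ker_snd_generator (C₂ := C₂) hg₁)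
    (by rwa [Nat.card_congr (kerSndEquiv C₁ C₂)]) 2 even_two
  exact (groupCohomology.coindIso (Rep.trivial k (MonoidHom.snd C₁ C₂).ker A)
    2).toLinearEquiv.toEquiv.subsingleton

theorem card_groupCohomology_three_coindTrivial_le [Finite C₁]
    (hg₁ : ∀ x : C₁, x ∈ Subgroup.zpowers g₁) [Finite {a : A // Nat.card C₁ • a = 0}] :
    Finite (groupCohomology (coindTrivial k C₁ C₂ A) 3) ∧
      Nat.card (groupCohomology (coindTrivial k C₁ C₂ A) 3) ≤
        Nat.card {a : A // Nat.card C₁ • a = 0} := by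
  have : Finite (MonoidHom.snd C₁ C₂).ker := Finite.of_equiv _ (kerSndEquiv C₁ C₂).symm
  have hc := Nat.card_congr (kerSndEquiv C₁ C₂)
  have : Finite {a : A // Nat.card (MonoidHom.snd C₁ C₂).ker • a = 0} := by rwa [hc]
  have h := card_groupCohomology_odd_le (k := k) (A := A) (ker_snd_generator (C₂ := C₂) hg₁)
    3 (by decide)
  rw [hc] at h
  have e := (groupCohomology.coindIso (Rep.trivial k (MonoidHom.snd C₁ C₂).ker A)
    3).toLinearEquiv.toEquiv
  have := h.1
  exact ⟨Finite.of_equiv _ e.symm, by rw [Nat.card_congr e]; exact h.2⟩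

open groupCohomology

/-- The character `g₁ ^ i * g₂ ^ j ↦ i • z` of `C₁ × C₂`, as a cocycle. -/
noncomputable def charFst (hg₁ : ∀ x : C₁, x ∈ Subgroup.zpowers g₁) (h₁ : 0 < orderOf g₁) {z : A}
    (hz : orderOf g₁ • z = 0) : cocycles₁ (Rep.trivial k (C₁ × C₂) A) :=
  ⟨fun x => exponent g₁ x.1 • z, (mem_cocycles₁_iff _).2 fun x y =>
    (exponent_mul_nsmul hg₁ h₁ hz x.1 y.1).trans (add_comm _ _)⟩

/-- The character `g₁ ^ i * g₂ ^ j ↦ j • z` of `C₁ × C₂`, as a cocycle. -/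
noncomputable def charSnd (hg₂ : ∀ x : C₂, x ∈ Subgroup.zpowers g₂) (h₂ : 0 < orderOf g₂) {z : A}
    (hz : orderOf g₂ • z = 0) : cocycles₁ (Rep.trivial k (C₁ × C₂) A) :=
  ⟨fun x => exponent g₂ x.2 • z, (mem_cocycles₁_iff _).2 fun x y =>
    (exponent_mul_nsmul hg₂ h₂ hz x.2 y.2).trans (add_comm _ _)⟩

/-- A 1-cocycle is a homomorphism, determined by its values at the two generators; these are
torsion, hence multiples of `z₁` and `z₂`. -/
theorem cocycles₁_trivial_eq (hg₁ : ∀ x : C₁, x ∈ Subgroup.zpowers g₁) (h₁ : 0 < orderOf g₁)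
    (hg₂ : ∀ x : C₂, x ∈ Subgroup.zpowers g₂) (h₂ : 0 < orderOf g₂) {z₁ z₂ : A}
    (hz₁ : orderOf g₁ • z₁ = 0) (hz₂ : orderOf g₂ • z₂ = 0)
    (ht₁ : ∀ a : A, orderOf g₁ • a = 0 → ∃ i : ℕ, a = i • z₁)
    (ht₂ : ∀ a : A, orderOf g₂ • a = 0 → ∃ i : ℕ, a = i • z₂)
    (c : cocycles₁ (Rep.trivial k (C₁ × C₂) A)) :
    ∃ i j : ℕ, c = i • charFst hg₁ h₁ hz₁ + j • charSnd hg₂ h₂ hz₂ := by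
  have hmul : ∀ x y, c (x * y) = c x + c y := cocycles₁_map_mul_of_isTrivial c
  have hpow : ∀ x (i : ℕ), c (x ^ i) = i • c x := fun x i => by
    induction i with
    | zero => simp
    | succ i ih => rw [pow_succ, hmul, ih, succ_nsmul]
  obtain ⟨i, hi⟩ := ht₁ (c (g₁, 1)) (by
    rw [← hpow, Prod.pow_mk, pow_orderOf_eq_one, one_pow]; exact cocycles₁_map_one c)
  obtain ⟨j, hj⟩ := ht₂ (c (1, g₂)) (by
    rw [← hpow, Prod.pow_mk, pow_orderOf_eq_one, one_pow]; exact cocycles₁_map_one c)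
  refine ⟨i, j, cocycles₁_ext fun x => ?_⟩
  have hx : x = (g₁, 1) ^ exponent g₁ x.1 * (1, g₂) ^ exponent g₂ x.2 := by
    ext <;> simp [pow_exponent hg₁ h₁, pow_exponent hg₂ h₂]
  conv_lhs => rw [hx, hmul, hpow, hpow, hi, hj]
  change _ = i • (exponent g₁ x.1 • z₁) + j • (exponent g₂ x.2 • z₂)
  rw [smul_comm, smul_comm j]

/-- The connecting map from `H¹(A)` is onto since `H²(X) = 0`, so the images of the two basic
characters generate. The gcd appears because the image of the first is killed by both orders. -/
theorem card_groupCohomology_two_kernel_le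
    (hg₁ : ∀ x : C₁, x ∈ Subgroup.zpowers g₁) (h₁ : 0 < orderOf g₁)
    (hg₂ : ∀ x : C₂, x ∈ Subgroup.zpowers g₂) (h₂ : 0 < orderOf g₂) {z₁ z₂ : A}
    (hz₁ : orderOf g₁ • z₁ = 0) (hz₂ : orderOf g₂ • z₂ = 0)
    (ht₁ : ∀ a : A, orderOf g₁ • a = 0 → ∃ i : ℕ, a = i • z₁)
    (ht₂ : ∀ a : A, orderOf g₂ • a = 0 → ∃ i : ℕ, a = i • z₂)
    (hX : Subsingleton (groupCohomology (coindTrivial k C₁ C₂ A) 2)) :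
    Finite (groupCohomology (Limits.kernel (coindTrivialSum k C₁ A hg₂ h₂)) 2) ∧
      Nat.card (groupCohomology (Limits.kernel (coindTrivialSum k C₁ A hg₂ h₂)) 2) ≤
        Nat.gcd (orderOf g₁) (orderOf g₂) * orderOf g₂ := by
  have := epi_coindTrivialSum (k := k) (C₁ := C₁) (A := A) hg₂ h₂
  have hS := shortExact_kernel (coindTrivialSum k C₁ A hg₂ h₂)
  have hepi : Epi (δ hS 1 2 rfl) :=
    epi_δ_of_isZero hS 1 (@ModuleCat.isZero_of_subsingleton _ _ _ hX)
  let L := (H1π (Rep.trivial k (C₁ × C₂) A) ≫ δ hS 1 2 rfl).hom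
  have hL : Function.Surjective L := (ModuleCat.epi_iff_surjective _).1 (epi_comp _ _)
  have hLmap : ∀ c : cocycles₁ (coindTrivial k C₁ C₂ A),
      δ hS 1 2 rfl (map (MonoidHom.id _) (coindTrivialSum k C₁ A hg₂ h₂) 1 (H1π _ c)) = 0 :=
    fun c => ConcreteCategory.congr_hom (mapShortComplex₃ hS (i := 1) (j := 2) rfl).zero (H1π _ c)
  have hn : orderOf g₂ • L (charFst hg₁ h₁ hz₁) = 0 := by
    -- The first character, with values seen as constant functions. Summing over `C₂` multiplies it
    -- by `orderOf g₂`, so this multiple comes from `H¹(X)` and dies under `δ`.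
    let c : cocycles₁ (coindTrivial k C₁ C₂ A) :=
      ⟨fun x => coindTrivialMk fun _ => exponent g₁ x.1 • z₁, (mem_cocycles₁_iff _).2 fun x y =>
        coindTrivial_ext fun _ =>
          (exponent_mul_nsmul hg₁ h₁ hz₁ x.1 y.1).trans (add_comm _ _)⟩
    have hc : mapCocycles₁ (MonoidHom.id _) (coindTrivialSum k C₁ A hg₂ h₂) c =
        orderOf g₂ • charFst hg₁ h₁ hz₁ := by
      refine cocycles₁_ext fun x => ?_
      change ∑ j ∈ Finset.range (orderOf g₂), exponent g₁ x.1 • z₁ =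
        orderOf g₂ • (exponent g₁ x.1 • z₁)
      simp
    rw [← map_nsmul, ← hLmap c, H1π_comp_map_apply, hc]
    rfl
  have hm : orderOf g₁ • L (charFst hg₁ h₁ hz₁) = 0 := by
    have h : orderOf g₁ • (charFst hg₁ h₁ hz₁ : cocycles₁ (Rep.trivial k (C₁ × C₂) A)) = 0 := by
      refine cocycles₁_ext fun x => ?_
      change orderOf g₁ • (exponent g₁ x.1 • z₁) = 0
      rw [smul_comm, hz₁, smul_zero]
    rw [← map_nsmul, h, map_zero]
  have hn' : orderOf g₂ • L (charSnd hg₂ h₂ hz₂) = 0 := by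
    have h : orderOf g₂ • (charSnd hg₂ h₂ hz₂ : cocycles₁ (Rep.trivial k (C₁ × C₂) A)) = 0 := by
      refine cocycles₁_ext fun x => ?_
      change orderOf g₂ • (exponent g₂ x.2 • z₂) = 0
      rw [smul_comm, hz₂, smul_zero]
    rw [← map_nsmul, h, map_zero]
  refine card_le_mul_of_generators (Nat.gcd_pos_of_pos_right _ h₂) h₂
    (addOrderOf_dvd_iff_nsmul_eq_zero.1 (Nat.dvd_gcd (addOrderOf_dvd_of_nsmul_eq_zero hm)
      (addOrderOf_dvd_of_nsmul_eq_zero hn))) hn' fun x => ?_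
  obtain ⟨c, rfl⟩ := hL x
  obtain ⟨i, j, rfl⟩ := cocycles₁_trivial_eq hg₁ h₁ hg₂ h₂ hz₁ hz₂ ht₁ ht₂ c
  exact ⟨i, j, by rw [map_add, map_nsmul, map_nsmul]⟩

theorem card_groupCohomology_three_le
    (hg₁ : ∀ x : C₁, x ∈ Subgroup.zpowers g₁) (h₁ : 0 < orderOf g₁)
    (hg₂ : ∀ x : C₂, x ∈ Subgroup.zpowers g₂) (h₂ : 0 < orderOf g₂) {z₁ z₂ : A}
    (hz₁ : orderOf g₁ • z₁ = 0) (hz₂ : orderOf g₂ • z₂ = 0)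
    (ht₁ : ∀ a : A, orderOf g₁ • a = 0 → ∃ i : ℕ, a = i • z₁)
    (ht₂ : ∀ a : A, orderOf g₂ • a = 0 → ∃ i : ℕ, a = i • z₂)
    (hA : ∀ a : A, ∃ b : A, orderOf g₁ • b = a) :
    Finite (groupCohomology (Rep.trivial k (C₁ × C₂) A) 3) ∧
      Nat.card (groupCohomology (Rep.trivial k (C₁ × C₂) A) 3) ≤
        Nat.gcd (orderOf g₁) (orderOf g₂) * orderOf g₂ * orderOf g₁ := by
  have hcard : Nat.card C₁ = orderOf g₁ := (orderOf_eq_card_of_forall_mem_zpowers hg₁).symm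
  have : Finite C₁ := Nat.finite_of_card_ne_zero (hcard ▸ h₁.ne')
  have htor : Finite {a : A // Nat.card C₁ • a = 0} ∧
      Nat.card {a : A // Nat.card C₁ • a = 0} ≤ orderOf g₁ := by
    rw [hcard]
    let f : Fin (orderOf g₁) → {a : A // orderOf g₁ • a = 0} := fun i =>
      ⟨(i : ℕ) • z₁, by rw [smul_comm, hz₁, smul_zero]⟩
    have hf : Function.Surjective f := fun a => by
      obtain ⟨i, hi⟩ := ht₁ a.1 a.2
      refine ⟨⟨i % orderOf g₁, Nat.mod_lt _ h₁⟩, Subtype.ext ?_⟩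
      rw [hi]
      conv_rhs => rw [← Nat.mod_add_div i (orderOf g₁), add_nsmul, mul_comm, mul_nsmul', hz₁,
        nsmul_zero, add_zero]
    exact ⟨Finite.of_surjective f hf, by simpa using Nat.card_le_card_of_surjective f hf⟩
  have := htor.1
  obtain ⟨hX3, hX3c⟩ := card_groupCohomology_three_coindTrivial_le (k := k) (C₂ := C₂) (A := A) hg₁
  obtain ⟨hB, hBc⟩ := card_groupCohomology_two_kernel_le (k := k) hg₁ h₁ hg₂ h₂ hz₁ hz₂ ht₁ ht₂
    (subsingleton_groupCohomology_two_coindTrivial hg₁ (by rwa [hcard]))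
  have := epi_coindTrivialSum (k := k) (C₁ := C₁) (A := A) hg₂ h₂
  have hS := shortExact_kernel_lift _ _ _ (coindTrivialConst_comp_diff g₂)
    (coindTrivialDiff_comp_sum (k := k) (C₁ := C₁) (A := A) hg₂ h₂)
    (exact_coindTrivialConst_diff hg₂ h₂) (exact_coindTrivialDiff_sum hg₂ h₂)
  have hE := mapShortComplex₁_exact hS (i := 2) (j := 3) rfl
  have : Finite (mapShortComplex₁ hS (i := 2) (j := 3) rfl).X₁ := hB
  have : Finite (mapShortComplex₁ hS (i := 2) (j := 3) rfl).X₃ := hX3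
  obtain ⟨hF, hFc⟩ := card_le_mul_of_exact hE
  exact ⟨hF, hFc.trans (Nat.mul_le_mul hBc (hX3c.trans htor.2))⟩

end Bound

/-! ### Explicit cocycles, coboundaries and a class invariant -/

section Cochains

variable {G K : Type u} [Group G] [Field K]

theorem d_apply (n : ℕ) (h : (Fin n → G) → unitsRep G K) (v : Fin (n + 1) → G) :
    inhomogeneousCochains.d (unitsRep G K) n h v = h (fun i => v i.succ) +
      ∑ j : Fin (n + 1), (-1 : ULift.{u} ℤ) ^ ((j : ℕ) + 1) • h (Fin.contractNth j (· * ·) v) :=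
  rfl

theorem d_two_apply (h : (Fin 2 → G) → unitsRep G K) (v : Fin 3 → G) :
    inhomogeneousCochains.d (unitsRep G K) 2 h v =
      h ![v 1, v 2] + h ![v 0, v 1 * v 2] - (h ![v 0 * v 1, v 2] + h ![v 0, v 1]) := by
  rw [d_apply, Fin.sum_univ_three]
  have h0 : (fun i : Fin 2 => v i.succ) = ![v 1, v 2] := by ext i; fin_cases i <;> rfl
  have h1 : Fin.contractNth (0 : Fin 3) (· * ·) v = ![v 0 * v 1, v 2] := by
    ext i; fin_cases i <;> rfl
  have h2 : Fin.contractNth (1 : Fin 3) (· * ·) v = ![v 0, v 1 * v 2] := by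
    ext i; fin_cases i <;> rfl
  have h3 : Fin.contractNth (2 : Fin 3) (· * ·) v = ![v 0, v 1] := by
    ext i; fin_cases i <;> rfl
  rw [h0, h1, h2, h3]
  simp
  abel

theorem d_three_apply (h : (Fin 3 → G) → unitsRep G K) (v : Fin 4 → G) :
    inhomogeneousCochains.d (unitsRep G K) 3 h v =
      h ![v 1, v 2, v 3] + h ![v 0, v 1 * v 2, v 3] + h ![v 0, v 1, v 2] -
        (h ![v 0 * v 1, v 2, v 3] + h ![v 0, v 1, v 2 * v 3]) := by
  rw [d_apply, Fin.sum_univ_four]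
  have h0 : (fun i : Fin 3 => v i.succ) = ![v 1, v 2, v 3] := by ext i; fin_cases i <;> rfl
  have h1 : Fin.contractNth (0 : Fin 4) (· * ·) v = ![v 0 * v 1, v 2, v 3] := by
    ext i; fin_cases i <;> rfl
  have h2 : Fin.contractNth (1 : Fin 4) (· * ·) v = ![v 0, v 1 * v 2, v 3] := by
    ext i; fin_cases i <;> rfl
  have h3 : Fin.contractNth (2 : Fin 4) (· * ·) v = ![v 0, v 1, v 2 * v 3] := by
    ext i; fin_cases i <;> rfl
  have h4 : Fin.contractNth (3 : Fin 4) (· * ·) v = ![v 0, v 1, v 2] := by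
    ext i; fin_cases i <;> rfl
  rw [h0, h1, h2, h3, h4]
  simp [pow_succ]
  abel

theorem isCocycle_iff {f : G → G → G → Kˣ} :
    IsCocycle f ↔ ∀ x y z w : G,
      f y z w * f x (y * z) w * f x y z = f (x * y) z w * f x y (z * w) := by
  have key : ∀ v : Fin 4 → G, inhomogeneousCochains.d (unitsRep G K) 3 (toCochain f) v =
      Additive.ofMul (f (v 1) (v 2) (v 3) * f (v 0) (v 1 * v 2) (v 3) * f (v 0) (v 1) (v 2) /
        (f (v 0 * v 1) (v 2) (v 3) * f (v 0) (v 1) (v 2 * v 3))) := fun v => by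
    rw [d_three_apply]
    rfl
  constructor
  · intro h x y z w
    have h' := congrFun h ![x, y, z, w]
    rw [key] at h'
    exact div_eq_one.1 h'
  · intro h
    funext v
    rw [key]
    exact div_eq_one.2 (h _ _ _ _)

theorem exists_of_cocycleClass_eq {f f' : G → G → G → Kˣ} {hf : IsCocycle f} {hf' : IsCocycle f'}
    (h : cocycleClass f hf = cocycleClass f' hf') :
    ∃ c : G → G → Kˣ, ∀ x y z : G,
      f x y z / f' x y z = c y z * c x (y * z) / (c (x * y) z * c x y) := by
  let A := unitsRep G K
  have hE : (ShortComplex.mk ((groupCohomology.inhomogeneousCochains A).toCycles 2 3)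
      (groupCohomology.π A 3)
      ((groupCohomology.inhomogeneousCochains A).toCycles_comp_homologyπ 2 3)).Exact :=
    ShortComplex.exact_of_g_is_cokernel _
      ((groupCohomology.inhomogeneousCochains A).homologyIsCokernel 2 3 (by simp))
  rw [ShortComplex.moduleCat_exact_iff] at hE
  obtain ⟨b, hb⟩ := hE (groupCohomology.cocyclesMk (toCochain f) hf -
    groupCohomology.cocyclesMk (toCochain f') hf') (by
      rw [map_sub]; exact sub_eq_zero.2 h)
  have hb' := congrArg (groupCohomology.iCocycles A 3) hb
  rw [map_sub, groupCohomology.iCocycles_mk _ hf, groupCohomology.iCocycles_mk _ hf'] at hb'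
  have hd : inhomogeneousCochains.d A 2 b = toCochain f - toCochain f' := by
    rw [← hb', ← groupCohomology.inhomogeneousCochains.d_def]
    exact (ConcreteCategory.congr_hom
      ((groupCohomology.inhomogeneousCochains A).toCycles_i 2 3) b).symm
  refine ⟨fun x y => Additive.toMul (b ![x, y]), fun x y z => ?_⟩
  have hv := congrFun hd ![x, y, z]
  rw [d_two_apply] at hv
  exact congrArg Additive.toMul hv.symm

theorem IsCocycle.mul {f f' : G → G → G → Kˣ} (hf : IsCocycle f) (hf' : IsCocycle f') :
    IsCocycle fun x y z => f x y z * f' x y z := by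
  rw [isCocycle_iff] at *
  intro x y z w
  rw [mul_mul_mul_comm (f (x * y) z w), ← hf, ← hf', mul_mul_mul_comm (f y z w),
    mul_mul_mul_comm (f y z w * _)]

/-- The cup product of a character and a `2`-cocycle with values in the integers. -/
theorem isCocycle_cup (α : G → Kˣ) (hα : ∀ x y, α (x * y) = α x * α y) (β : G → G → ℕ)
    (hβ : ∀ y z w, β (y * z) w + β y z = β z w + β y (z * w)) :
    IsCocycle fun x y z => α x ^ β y z := by
  rw [isCocycle_iff]
  intro x y z w
  rw [mul_assoc, ← pow_add, hβ, pow_add, hα, mul_pow, mul_left_comm, mul_assoc, mul_left_comm]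

/-- On `(g, g ^ i, g)` a coboundary is `u (i + 1) / u i` with `u i = c g (g ^ i) / c (g ^ i) g`; the
product telescopes to `u N / u 0`, which is `1` as `g ^ N = 1`. -/
theorem prod_eq_of_coboundary {f f' : G → G → G → Kˣ} {c : G → G → Kˣ}
    (h : ∀ x y z : G, f x y z / f' x y z = c y z * c x (y * z) / (c (x * y) z * c x y))
    (g : G) (N : ℕ) (hN : g ^ N = 1) :
    ∏ i ∈ Finset.range N, f g (g ^ i) g = ∏ i ∈ Finset.range N, f' g (g ^ i) g := by
  rw [← div_eq_one, ← Finset.prod_div_distrib]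
  have : ∀ i, f g (g ^ i) g / f' g (g ^ i) g =
      (c g (g ^ (i + 1)) / c (g ^ (i + 1)) g) / (c g (g ^ i) / c (g ^ i) g) := fun i => by
    rw [h, ← pow_succ, ← pow_succ', div_div_div_eq, mul_comm (c (g ^ i) g)]
  simp only [this]
  rw [Finset.prod_range_div (fun i => c g (g ^ i) / c (g ^ i) g), hN, pow_zero, div_self']

end Cochains

/-! ### The carry cocycle of a cyclic group -/

section Carry

variable {C K : Type u} [Group C] [Field K] {g : C}

theorem orderOf_mul_carry_add (hg : ∀ x : C, x ∈ Subgroup.zpowers g) (h0 : 0 < orderOf g)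
    (y z : C) :
    orderOf g * ((exponent g z + exponent g y) / orderOf g) + exponent g (y * z) =
      exponent g z + exponent g y := by
  have h : exponent g (y * z) = (exponent g z + exponent g y) % orderOf g := by
    conv_lhs => rw [← pow_exponent hg h0 y, ← pow_exponent hg h0 z, ← pow_add, add_comm,
      ← pow_mod_orderOf]
    exact exponent_pow g (Nat.mod_lt _ h0)
  rw [h, Nat.div_add_mod]

/-- Multiplied by `orderOf g`, the carry is the coboundary of `exponent g`; the factor cancels in
`ℕ`. -/
theorem carry_cocycle (hg : ∀ x : C, x ∈ Subgroup.zpowers g) (h0 : 0 < orderOf g) (y z w : C) :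
    (exponent g w + exponent g (y * z)) / orderOf g + (exponent g z + exponent g y) / orderOf g =
      (exponent g w + exponent g z) / orderOf g +
        (exponent g (z * w) + exponent g y) / orderOf g := by
  have h1 := orderOf_mul_carry_add hg h0 (y * z) w
  have h2 := orderOf_mul_carry_add hg h0 y z
  have h3 := orderOf_mul_carry_add hg h0 z w
  have h4 := orderOf_mul_carry_add hg h0 y (z * w)
  rw [mul_assoc] at h1
  refine Nat.eq_of_mul_eq_mul_left h0 ?_
  rw [mul_add, mul_add]
  lia

theorem exponent_one (h0 : 0 < orderOf g) : exponent g 1 = 0 := by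
  simpa using exponent_pow g h0

theorem exponent_self (h : 1 < orderOf g) : exponent g g = 1 := by
  simpa using exponent_pow g h

/-- Going through the powers of `x`, the exponents telescope and return to `0` at `x ^ N = 1`. -/
theorem orderOf_mul_sum_carry (hg : ∀ x : C, x ∈ Subgroup.zpowers g) (h0 : 0 < orderOf g)
    {x : C} {N : ℕ} (hN : x ^ N = 1) :
    orderOf g * ∑ i ∈ Finset.range N, (exponent g x + exponent g (x ^ i)) / orderOf g =
      N * exponent g x := by
  have key : ∀ M : ℕ, orderOf g * ∑ i ∈ Finset.range M,
      (exponent g x + exponent g (x ^ i)) / orderOf g + exponent g (x ^ M) =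
        M * exponent g x := fun M => by
    induction M with
    | zero => simp [exponent_one h0]
    | succ M ih =>
      have := orderOf_mul_carry_add hg h0 (x ^ M) x
      rw [← pow_succ] at this
      rw [Finset.sum_range_succ, mul_add, add_mul, one_mul]
      lia
  have := key N
  rwa [hN, exponent_one h0, add_zero] at this

theorem pow_exponent_mul (hg : ∀ x : C, x ∈ Subgroup.zpowers g) (h0 : 0 < orderOf g) {ζ : Kˣ}
    (hζ : ζ ^ orderOf g = 1) (x y : C) :
    ζ ^ exponent g (x * y) = ζ ^ exponent g x * ζ ^ exponent g y :=
  exponent_mul_nsmul (A := Additive Kˣ) hg h0 (z := Additive.ofMul ζ) hζ x y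

end Carry

/-! ### The cocycles `Phi` and their separation -/

section Phi

variable {K C₁ C₂ : Type u} [Field K] [Group C₁] [Group C₂] {g₁ : C₁} {g₂ : C₂} {ζ₁ ζ₂ : Kˣ}

theorem Phi_isNormalized (h₁ : 0 < orderOf g₁) (h₂ : 0 < orderOf g₂)
    (hg₁ : ∀ x : C₁, x ∈ Subgroup.zpowers g₁) (hg₂ : ∀ x : C₂, x ∈ Subgroup.zpowers g₂)
    (a b d : ℕ) : IsNormalized (Phi (orderOf g₁) (orderOf g₂) g₁ g₂ ζ₁ ζ₂ a b d) := by
  intro x y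
  simp [Phi, exponent_one h₁, exponent_one h₂, Nat.div_eq_of_lt (exponent_lt hg₁ h₁ _),
    Nat.div_eq_of_lt (exponent_lt hg₂ h₂ _)]

/-- Each of the three factors is the cup product of a character with a carry cocycle. -/
theorem Phi_isCocycle (h₁ : 0 < orderOf g₁) (h₂ : 0 < orderOf g₂)
    (hg₁ : ∀ x : C₁, x ∈ Subgroup.zpowers g₁) (hg₂ : ∀ x : C₂, x ∈ Subgroup.zpowers g₂)
    (hζ₁ : ζ₁ ^ orderOf g₁ = 1) (hζ₂ : ζ₂ ^ orderOf g₂ = 1) (a b d : ℕ) :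
    IsCocycle (Phi (orderOf g₁) (orderOf g₂) g₁ g₂ ζ₁ ζ₂ a b d) := by
  have e₁ := pow_exponent_mul hg₁ h₁ hζ₁
  have e₂ := pow_exponent_mul hg₂ h₂ hζ₂
  have cup₁ (ζ : Kˣ) (α : C₁ × C₂ → ℕ) (hα : ∀ x y, ζ ^ α (x * y) = ζ ^ α x * ζ ^ α y) (r : ℕ) :=
    isCocycle_cup (fun x => (ζ ^ α x) ^ r) (fun x y => by rw [← mul_pow, ← hα])
      (fun y z => (exponent g₁ z.1 + exponent g₁ y.1) / orderOf g₁)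
      fun y z w => carry_cocycle hg₁ h₁ y.1 z.1 w.1
  have c₁ := cup₁ ζ₁ (fun x => exponent g₁ x.1) (fun x y => e₁ x.1 y.1) a
  have c₂ := cup₁ ζ₂ (fun x => exponent g₂ x.2) (fun x y => e₂ x.2 y.2) b
  have c₃ := isCocycle_cup (G := C₁ × C₂) (fun x => (ζ₂ ^ exponent g₂ x.2) ^ d)
    (fun x y => by rw [← mul_pow, ← e₂]; rfl)
    (fun y z => (exponent g₂ z.2 + exponent g₂ y.2) / orderOf g₂)
    fun y z w => carry_cocycle hg₂ h₂ y.2 z.2 w.2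
  convert (c₁.mul c₂).mul c₃ using 4 with x y z
  simp only [Phi, ← pow_mul]
  rw [add_comm (exponent g₂ y.2)]
  congr 1
  · congr 1 <;> (congr 1; ring)
  · congr 1; ring

theorem prod_Phi (m n a b d : ℕ) (g : C₁ × C₂) (N : ℕ) :
    ∏ i ∈ Finset.range N, Phi m n g₁ g₂ ζ₁ ζ₂ a b d g (g ^ i) g =
      ζ₁ ^ (a * exponent g₁ g.1 *
          ∑ i ∈ Finset.range N, (exponent g₁ g.1 + exponent g₁ (g.1 ^ i)) / m) *
        ζ₂ ^ (b * exponent g₂ g.2 *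
          ∑ i ∈ Finset.range N, (exponent g₁ g.1 + exponent g₁ (g.1 ^ i)) / m) *
        ζ₂ ^ (d * exponent g₂ g.2 *
          ∑ i ∈ Finset.range N, (exponent g₂ g.2 + exponent g₂ (g.2 ^ i)) / n) := by
  simp only [Phi, Finset.prod_mul_distrib, Finset.prod_pow_eq_pow_sum, Finset.mul_sum,
    Prod.pow_fst, Prod.pow_snd]
  congr 3
  · exact Finset.sum_congr rfl fun i _ => by ring
  · exact Finset.sum_congr rfl fun i _ => by ring
  · funext i
    rw [add_comm (exponent g₂ g.2)]
    ring

theorem Phi_injective (h₁ : 0 < orderOf g₁) (h₂ : 0 < orderOf g₂)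
    (hg₁ : ∀ x : C₁, x ∈ Subgroup.zpowers g₁) (hg₂ : ∀ x : C₂, x ∈ Subgroup.zpowers g₂)
    (hζ₁ : IsPrimitiveRoot ζ₁ (orderOf g₁)) (hζ₂ : IsPrimitiveRoot ζ₂ (orderOf g₂))
    {a b d a' b' d' : ℕ} (ha : a < orderOf g₁) (ha' : a' < orderOf g₁)
    (hb : b < Nat.gcd (orderOf g₁) (orderOf g₂)) (hb' : b' < Nat.gcd (orderOf g₁) (orderOf g₂))
    (hd : d < orderOf g₂) (hd' : d' < orderOf g₂)
    (h : ∀ (g : C₁ × C₂) (N : ℕ), g ^ N = 1 →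
      ∏ i ∈ Finset.range N,
          Phi (orderOf g₁) (orderOf g₂) g₁ g₂ ζ₁ ζ₂ a b d g (g ^ i) g =
        ∏ i ∈ Finset.range N,
          Phi (orderOf g₁) (orderOf g₂) g₁ g₂ ζ₁ ζ₂ a' b' d' g (g ^ i) g) :
    a = a' ∧ b = b' ∧ d = d' := by
  simp only [prod_Phi] at h
  have haa : a = a' := by
    -- For order one the generator has exponent `0`, not `1`, but then `a = a' = 0`.
    rcases Nat.eq_or_lt_of_le (Nat.succ_le_of_lt h₁) with h1 | h1
    · lia
    have hs := orderOf_mul_sum_carry hg₁ h₁ (pow_orderOf_eq_one g₁)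
    have := h (g₁, 1) (orderOf g₁) (by simp [pow_orderOf_eq_one])
    simp only [exponent_self h1] at this hs
    rw [Nat.eq_of_mul_eq_mul_left h₁ hs] at this
    simp only [exponent_one h₂, mul_zero, zero_mul, pow_zero, mul_one] at this
    exact hζ₁.pow_inj ha ha' this
  have hdd : d = d' := by
    rcases Nat.eq_or_lt_of_le (Nat.succ_le_of_lt h₂) with h1 | h1
    · lia
    have hs := orderOf_mul_sum_carry hg₂ h₂ (pow_orderOf_eq_one g₂)
    have hs₁ := orderOf_mul_sum_carry hg₁ h₁ (x := 1) (one_pow (orderOf g₂))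
    have := h (1, g₂) (orderOf g₂) (by simp [pow_orderOf_eq_one])
    simp only [exponent_self h1, exponent_one h₁] at this hs hs₁
    rw [Nat.eq_of_mul_eq_mul_left h₂ hs, Nat.eq_of_mul_eq_mul_left h₁ (hs₁.trans (by rw [mul_zero, mul_zero] : _ = orderOf g₁ * 0))]
      at this
    simp only [mul_zero, pow_zero, mul_one, one_mul] at this
    exact hζ₂.pow_inj hd hd' this
  refine ⟨haa, ?_, hdd⟩
  subst haa hdd
  rcases Nat.eq_or_lt_of_le (Nat.succ_le_of_lt h₁) with h1 | h1
  · rw [← h1] at hb hb'; simp at hb hb'; lia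
  rcases Nat.eq_or_lt_of_le (Nat.succ_le_of_lt h₂) with h2 | h2
  · rw [← h2] at hb hb'; simp at hb hb'; lia
  have hN : g₁ ^ Nat.lcm (orderOf g₁) (orderOf g₂) = 1 :=
    orderOf_dvd_iff_pow_eq_one.1 (Nat.dvd_lcm_left _ _)
  have hN' : g₂ ^ Nat.lcm (orderOf g₁) (orderOf g₂) = 1 :=
    orderOf_dvd_iff_pow_eq_one.1 (Nat.dvd_lcm_right _ _)
  have hs := orderOf_mul_sum_carry hg₁ h₁ hN
  have := h (g₁, g₂) _ (Prod.ext hN hN')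
  simp only [exponent_self h1, exponent_self h2, mul_one] at this hs
  set S := ∑ i ∈ Finset.range (Nat.lcm (orderOf g₁) (orderOf g₂)),
    (1 + exponent g₁ (g₁ ^ i)) / orderOf g₁
  -- There are `lcm / m = n / gcd` carries, so `b < gcd` puts the exponent `b * S` below `n`, where
  -- powers of `ζ₂` are distinct.
  have hS : Nat.gcd (orderOf g₁) (orderOf g₂) * S = orderOf g₂ := by
    refine Nat.eq_of_mul_eq_mul_left h₁ ?_
    rw [mul_left_comm, hs, Nat.gcd_mul_lcm]
  have hS0 : 0 < S := Nat.pos_of_ne_zero fun h0 => by rw [h0, mul_zero] at hS; lia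
  rw [mul_left_inj, mul_right_inj] at this
  refine Nat.eq_of_mul_eq_mul_right hS0 (hζ₂.pow_inj ?_ ?_ this)
  · exact hS ▸ Nat.mul_lt_mul_of_pos_right hb hS0
  · exact hS ▸ Nat.mul_lt_mul_of_pos_right hb' hS0

end Phi

theorem exists_nsmul_of_isPrimitiveRoot {K : Type u} [Field K] {ζ : Kˣ} {m : ℕ} (hm : 0 < m)
    (hζ : IsPrimitiveRoot ζ m) (a : Additive Kˣ) (ha : m • a = 0) :
    ∃ i : ℕ, a = i • Additive.ofMul ζ := by
  have : NeZero m := ⟨hm.ne'⟩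
  have ha' : (a.toMul : K) ^ m = 1 := by
    rw [← Units.val_pow_eq_pow_val, show a.toMul ^ m = 1 from ha, Units.val_one]
  obtain ⟨i, -, hi⟩ := (IsPrimitiveRoot.coe_units_iff.2 hζ).eq_pow_of_pow_eq_one ha'
  exact ⟨i, congrArg Additive.ofMul (Units.ext (by rw [← hi, Units.val_pow_eq_pow_val]) :
    a.toMul = ζ ^ i)⟩

theorem exists_nsmul_eq_of_isAlgClosed {K : Type u} [Field K] [IsAlgClosed K] {m : ℕ} (hm : 0 < m)
    (a : Additive Kˣ) : ∃ b : Additive Kˣ, m • b = a := by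
  obtain ⟨z, hz⟩ := IsAlgClosed.exists_pow_nat_eq (a.toMul : K) hm
  have hz0 : z ≠ 0 := by
    rintro rfl
    rw [zero_pow hm.ne'] at hz
    exact a.toMul.ne_zero hz.symm
  exact ⟨Additive.ofMul (Units.mk0 z hz0), congrArg Additive.ofMul (Units.ext hz)⟩

theorem card_groupCohomology_unitsRep_le {K C₁ C₂ : Type u} [Field K] [IsAlgClosed K]
    [I₁ : Group C₁] [I₂ : Group C₂] {g₁ : C₁} {g₂ : C₂} {ζ₁ ζ₂ : Kˣ}
    (h₁ : 0 < orderOf g₁) (h₂ : 0 < orderOf g₂)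
    (hg₁ : ∀ x : C₁, x ∈ Subgroup.zpowers g₁) (hg₂ : ∀ x : C₂, x ∈ Subgroup.zpowers g₂)
    (hζ₁ : IsPrimitiveRoot ζ₁ (orderOf g₁)) (hζ₂ : IsPrimitiveRoot ζ₂ (orderOf g₂)) :
    Finite (groupCohomology (unitsRep (C₁ × C₂) K) 3) ∧
      Nat.card (groupCohomology (unitsRep (C₁ × C₂) K) 3) ≤
        Nat.gcd (orderOf g₁) (orderOf g₂) * orderOf g₂ * orderOf g₁ := by
  obtain ⟨J₁, rfl⟩ := exists_commGroup_of_generator hg₁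
  obtain ⟨J₂, rfl⟩ := exists_commGroup_of_generator hg₂
  exact card_groupCohomology_three_le hg₁ h₁ hg₂ h₂ hζ₁.pow_eq_one hζ₂.pow_eq_one
    (exists_nsmul_of_isPrimitiveRoot h₁ hζ₁) (exists_nsmul_of_isPrimitiveRoot h₂ hζ₂)
    (exists_nsmul_eq_of_isAlgClosed h₁)

end TwoCyclic

theorem proposition3p9 {K : Type u} [Field K] [IsAlgClosed K] [CharZero K]
    {C₁ C₂ : Type u} [Group C₁] [Group C₂] (m n : ℕ) (hm : 0 < m) (hn : 0 < n)
    (g₁ : C₁) (g₂ : C₂)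
    (hg₁ : ∀ x : C₁, x ∈ Subgroup.zpowers g₁) (hg₂ : ∀ x : C₂, x ∈ Subgroup.zpowers g₂)
    (ho₁ : orderOf g₁ = m) (ho₂ : orderOf g₂ = n)
    (ζm ζn : Kˣ) (hζm : IsPrimitiveRoot ζm m) (hζn : IsPrimitiveRoot ζn n) :
    (∀ a b d i j s t k l : ℕ, i < m → j < n → s < m → t < n → k < m → l < n →
      TwoCyclic.Phi m n g₁ g₂ ζm ζn a b d
          (g₁ ^ i, g₂ ^ j) (g₁ ^ s, g₂ ^ t) (g₁ ^ k, g₂ ^ l) =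
        ζm ^ (a * ((k + s) / m) * i) * ζn ^ (b * ((k + s) / m) * j) *
          ζn ^ (d * ((t + l) / n) * j)) ∧
    (∀ a b d : ℕ, TwoCyclic.IsNormalized (TwoCyclic.Phi m n g₁ g₂ ζm ζn a b d)) ∧
    ∃ hcoc : ∀ a b d : ℕ, TwoCyclic.IsCocycle (TwoCyclic.Phi m n g₁ g₂ ζm ζn a b d),
      Function.Bijective fun p : Fin m × Fin (Nat.gcd m n) × Fin n =>
        TwoCyclic.cocycleClass (TwoCyclic.Phi m n g₁ g₂ ζm ζn p.1 p.2.1 p.2.2)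
          (hcoc p.1 p.2.1 p.2.2) := by
  subst ho₁ ho₂
  have hcoc := TwoCyclic.Phi_isCocycle hm hn hg₁ hg₂ hζm.pow_eq_one hζn.pow_eq_one
  refine ⟨fun a b d i j s t k l hi hj hs ht hk hl => ?_,
    TwoCyclic.Phi_isNormalized hm hn hg₁ hg₂, hcoc, ?_⟩
  · simp only [TwoCyclic.Phi, TwoCyclic.exponent_pow, hi, hj, hs, ht, hk, hl]
  obtain ⟨hfin, hcard⟩ := TwoCyclic.card_groupCohomology_unitsRep_le hm hn hg₁ hg₂ hζm hζn
  refine Function.Injective.bijective_of_nat_card_le ?_ (hcard.trans (le_of_eq ?_))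
  · rintro ⟨a, b, d⟩ ⟨a', b', d'⟩ h
    obtain ⟨c, hc⟩ := TwoCyclic.exists_of_cocycleClass_eq h
    obtain ⟨ha, hb, hd⟩ := TwoCyclic.Phi_injective hm hn hg₁ hg₂ hζm hζn a.2 a'.2 b.2 b'.2 d.2 d'.2
      fun g N hN => TwoCyclic.prod_eq_of_coboundary hc g N hN
    rw [Fin.ext ha, Fin.ext hb, Fin.ext hd]
  · simp only [Nat.card_prod, Nat.card_fin]
    ring
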